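/- A \emph{KCBS-system} consists of ten $\pm1$-valued random variables $V_1,\dots,V_5,W_1,\dots,W_5$, organized in five pairs $(V_i,W_{i\oplus 1})$, $i\in\{1,\dots,5\}$, where $\oplus$ is circular addition on $\{1,\dots,5\}$ (so $5\oplus1=1$). The two members of each pair are jointly distributed (arbitrarily); different pairs are defined on different sample spaces. The \emph{connections} are the pairs $\{V_i,W_i\}$, $i\in\{1,\dots,5\}$. A \emph{coupling} of the system is a family $(V_i^*,W_i^*)_{i=1}^5$ of random variables on a single probability space such that $(V_i^*,W_{i\oplus1}^*)$ has the same distribution as $(V_i,W_{i\oplus1})$ for every $i$. A coupling $(A^*,B^*)$ of two random variables $A,B$ (i.e. jointly distributed $A^*,B^*$ with $A^*\sim A$, $B^*\sim B$) is \emph{maximal} if $\Pr[A^*=B^*]\ge\Pr[A^{**}=B^{**}]$ for every coupling $(A^{**},B^{**})$ of $A,B$. The system \emph{has a noncontextual description} if it has a coupling in which $(V_i^*,W_i^*)$ is a maximal coupling of $V_i,W_i$ for every $i$. Let $\Delta_{\min}$ be the infimum of $\sum_{i=1}^5\Pr[V_i^*\neq W_i^*]$ over all couplings of the system, let $$\Delta_0=\frac12\sum_{i=1}^5\left|\langle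 V_i\rangle-\langle W_i\rangle\right|,$$ where $\langle\cdot\rangle$ denotes expectation, and let $\mathsf{CNTX}=\Delta_{\min}-\Delta_0$ be the \emph{degree of contextuality}. For real numbers $a_1,\dots,a_n$ let $\mathsf{s}_{odd}(a_1,\dots,a_n)$ be the maximum of $\sum_{i=1}^n(\pm a_i)$ over all choices of signs with an odd number of minus signs. \textbf{Theorem} (contextuality measure and criterion for KCBS-systems). For every KCBS-system, $$\Delta_{\min}=\frac12\max\Bigl(2\Delta_0,\ \mathsf{s}_{odd}\bigl(\langle V_iW_{i\oplus1}\rangle: i\in\{1,\dots,5\}\bigr)-3\Bigr).$$ Consequently, $$\mathsf{CNTX}=\frac12\max\Bigl(0,\ \mathsf{s}_{odd}\bigl(\langle V_iW_{i\oplus1}\rangle: i\in\{1,\dots,5\}\bigr)-3-\sum_{i=1}^5\left|\langle V_i\rangle-\langle W_i\rangle\right|\Bigr),$$ and the system has a noncontextual description if and only if $$\mathsf{s}_{odd}\bigl(\langle V_iW_{i\oplus1}\rangle: i\in\{1,\dots,5\}\bigr)\le 3+\sum_{i=1}^5\left|\langle V_i\rangle-\langle W_i\rangle\right|.$$ -/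

import Mathlib

open MeasureTheory ProbabilityTheory

universe u v

/-- A sum `∑ (± a i)` in which the minus signs stand exactly at the indices in `T`. -/
def signedSum {ι : Type*} [Fintype ι] [DecidableEq ι] (a : ι → ℝ) (T : Finset ι) : ℝ :=
  ∑ i, (if i ∈ T then -a i else a i)

/-- The sets of positions for an odd number of minus signs. -/
def oddSets (ι : Type*) [Fintype ι] [DecidableEq ι] : Finset (Finset ι) :=
  Finset.univ.filter fun T => Odd T.card

theorem oddSets_nonempty (ι : Type*) [Fintype ι] [DecidableEq ι] [Nonempty ι] :
    (oddSets ι).Nonempty := by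
  obtain ⟨i⟩ := ‹Nonempty ι›
  exact ⟨{i}, by simp [oddSets]⟩

/-- `s_odd`: the maximum of `∑ (± a i)` over all choices of signs with an odd number of minuses. -/
noncomputable def sOdd {ι : Type*} [Fintype ι] [DecidableEq ι] [Nonempty ι] (a : ι → ℝ) : ℝ :=
  (oddSets ι).sup' (oddSets_nonempty ι) (signedSum a)

/-- `(A', B')`, jointly distributed on `(Ω, P)`, is a coupling of the random variables `A` on
`(α, μ)` and `B` on `(β, ν)`. -/
structure IsPairCoupling {α β : Type u} [MeasurableSpace α] [MeasurableSpace β]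
    (μ : Measure α) (ν : Measure β) (A : α → ℝ) (B : β → ℝ)
    {Ω : Type v} [MeasurableSpace Ω] (P : Measure Ω) (A' B' : Ω → ℝ) : Prop where
  measurable_left : Measurable A'
  measurable_right : Measurable B'
  identDistrib_left : IdentDistrib A' A P μ
  identDistrib_right : IdentDistrib B' B P ν

/-- `(A', B')` is a maximal coupling of `A` and `B`: `Pr[A' = B']` is at least `Pr[A'' = B'']` for
every coupling `(A'', B'')` of `A` and `B`. -/
def IsMaximalCoupling {α β : Type u} [MeasurableSpace α] [MeasurableSpace β]
    (μ : Measure α) (ν : Measure β) (A : α → ℝ) (B : β → ℝ)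
    {Ω : Type v} [MeasurableSpace Ω] (P : Measure Ω) (A' B' : Ω → ℝ) : Prop :=
  IsPairCoupling μ ν A B P A' B' ∧
    ∀ (Ω'' : Type v) [MeasurableSpace Ω''] (Q : Measure Ω'') [IsProbabilityMeasure Q]
      (A'' B'' : Ω'' → ℝ), IsPairCoupling μ ν A B Q A'' B'' →
        Q.real {ω | A'' ω = B'' ω} ≤ P.real {ω | A' ω = B' ω}

/-- A KCBS-system: five pairs `(V i, W (i ⊕ 1))` of binary (`±1`) random variables; different pairs
live on different sample spaces. Indices are in `Fin 5`, whose addition is circular. The component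
`W (i ⊕ 1)` of the `i`-th pair is the field `Wnext i`. -/
structure KCBSSystem where
  Ω : Fin 5 → Type u
  [measurableSpace : ∀ i, MeasurableSpace (Ω i)]
  P : ∀ i, Measure (Ω i)
  [isProbabilityMeasure : ∀ i, IsProbabilityMeasure (P i)]
  V : ∀ i, Ω i → ℝ
  Wnext : ∀ i, Ω i → ℝ
  measurable_V : ∀ i, Measurable (V i)
  measurable_Wnext : ∀ i, Measurable (Wnext i)
  binary_V : ∀ i ω, V i ω = 1 ∨ V i ω = -1
  binary_Wnext : ∀ i ω, Wnext i ω = 1 ∨ Wnext i ω = -1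

attribute [instance] KCBSSystem.measurableSpace KCBSSystem.isProbabilityMeasure

namespace KCBSSystem

/-- `W i` is recorded together with `V (i ⊖ 1)`. -/
def W (S : KCBSSystem.{u}) (i : Fin 5) : S.Ω (i - 1) → ℝ := S.Wnext (i - 1)

/-- The expectation `⟨V i⟩`. -/
noncomputable def meanV (S : KCBSSystem.{u}) (i : Fin 5) : ℝ := ∫ ω, S.V i ω ∂(S.P i)

/-- The expectation `⟨W i⟩`. -/
noncomputable def meanW (S : KCBSSystem.{u}) (i : Fin 5) : ℝ := ∫ ω, S.W i ω ∂(S.P (i - 1))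

/-- The product expectation `⟨V i * W (i ⊕ 1)⟩` of the `i`-th pair. -/
noncomputable def corr (S : KCBSSystem.{u}) (i : Fin 5) : ℝ :=
  ∫ ω, S.V i ω * S.Wnext i ω ∂(S.P i)

/-- A coupling of the five pairs: jointly distributed `V i`, `W i` on one probability space such
that each `(V i, W (i ⊕ 1))` has the same distribution as the corresponding pair of the system. -/
structure Coupling (S : KCBSSystem.{u}) where
  Ω : Type v
  [measurableSpace : MeasurableSpace Ω]
  P : Measure Ω
  [isProbabilityMeasure : IsProbabilityMeasure P]
  V : Fin 5 → Ω → ℝ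
  W : Fin 5 → Ω → ℝ
  measurable_V : ∀ i, Measurable (V i)
  measurable_W : ∀ i, Measurable (W i)
  identDistrib : ∀ i, IdentDistrib (fun ω => (V i ω, W (i + 1) ω))
    (fun ω => (S.V i ω, S.Wnext i ω)) P (S.P i)

attribute [instance] Coupling.measurableSpace Coupling.isProbabilityMeasure

/-- `∑ i, Pr[V i ≠ W i]` in a coupling. -/
noncomputable def Coupling.mismatch {S : KCBSSystem.{u}} (c : Coupling.{u, v} S) : ℝ :=
  ∑ i, c.P.real {ω | c.V i ω ≠ c.W i ω}

/-- `Δ₀`. -/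
noncomputable def delta0 (S : KCBSSystem.{u}) : ℝ :=
  (1 / 2) * ∑ i, |S.meanV i - S.meanW i|

/-- `Δ_min`: the infimum of `∑ i, Pr[V i ≠ W i]` across all couplings of the system. -/
noncomputable def deltaMin (S : KCBSSystem.{u}) : ℝ :=
  sInf (Set.range fun c : Coupling.{u, v} S => c.mismatch)

/-- The degree of contextuality. -/
noncomputable def cntx (S : KCBSSystem.{u}) : ℝ := deltaMin.{u, v} S - S.delta0

/-- The system has a (maximally) noncontextual description: in some coupling of the system, all
the pairs `(V i, W i)` are maximal couplings of the connections. -/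
def Noncontextual (S : KCBSSystem.{u}) : Prop :=
  ∃ c : Coupling.{u, v} S, ∀ i,
    IsMaximalCoupling (S.P i) (S.P (i - 1)) (S.V i) (S.W i) c.P (c.V i) (c.W i)

end KCBSSystem

/-!
The ten variables form a cycle `V 0, W 1, V 1, W 2, …, V 4, W 0`, in which the five contexts
`V i, W (i + 1)` have prescribed laws and alternate with the five connections `V i, W i`. The law of a
pair of sign variables is determined by its two means and its correlation
(`identDistrib_sign_pair`), so everything is a question about correlations, and
`Pr[V i ≠ W i] = (1 - ⟨V i W i⟩) / 2`.

*Lower bound.* In a coupling, `|⟨V i⟩ - ⟨W i⟩| ≤ 1 - ⟨V i W i⟩`, which gives `Δ₀`. The product of the ten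
products of neighbours in the cycle is `1`; after an odd number of sign changes it is `-1`, so the
sum of the ten terms is at most `8` (`KCBSSystem.sum_signs_le_eight`). Integration gives
`sOdd corr + ∑ ⟨V i W i⟩ ≤ 8`, that is, `sOdd corr - 3 ≤ 2 * mismatch`.

*Upper bound.* A coupling is built along the chain from `V 0` to `W 0`, adjoining one sign variable
at a time and keeping track only of its correlation with `V 0`. Three sign variables with compatible
pair correlations exist as soon as the four triangle inequalities hold
(`ChainRealizable.succ`), because the third-order moment is free. With the connections inside the
chain coupled maximally, an induction shows that the correlation of the two ends can be anything in
the interval cut out by the means and by the signed sums of the context correlations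
(`chainRealizable_of_window`); in each step two intervals have to meet, which amounts to comparing
their end points. If the two ends, which form the remaining connection, are given the largest
correlation in this interval, the mismatch equals the lower bound
(`KCBSSystem.exists_coupling_mismatch_le`).

A coupling consists of maximal couplings of the connections exactly when its mismatch is `Δ₀`
(`KCBSSystem.Coupling.forall_isMaximalCoupling_iff`), since each connection alone can attain
`|⟨V i⟩ - ⟨W i⟩| / 2`; so the criterion follows from the formula for `Δ_min`, as it is attained.
-/

/-! ### Expectations of two sign variables -/

/-- A function of two signs is a combination of `1`, `a`, `b` and `a * b`; hence the joint law of two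
sign variables is determined by their means and their correlation. -/
theorem sign_expansion (g : ℝ → ℝ → ℝ) {a b : ℝ} (ha : a = 1 ∨ a = -1) (hb : b = 1 ∨ b = -1) :
    g a b = (g 1 1 + g 1 (-1) + g (-1) 1 + g (-1) (-1)) / 4
      + (g 1 1 + g 1 (-1) - g (-1) 1 - g (-1) (-1)) / 4 * a
      + (g 1 1 - g 1 (-1) + g (-1) 1 - g (-1) (-1)) / 4 * b
      + (g 1 1 - g 1 (-1) - g (-1) 1 + g (-1) (-1)) / 4 * (a * b) := by
  rcases ha with rfl | rfl <;> rcases hb with rfl | rfl <;> ring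

section SignVariables

variable {Ω : Type*} [MeasurableSpace Ω] {P : Measure Ω} {A B : Ω → ℝ}

theorem ae_sign_mul (hAs : ∀ᵐ ω ∂P, A ω = 1 ∨ A ω = -1) (hBs : ∀ᵐ ω ∂P, B ω = 1 ∨ B ω = -1) :
    ∀ᵐ ω ∂P, A ω * B ω = 1 ∨ A ω * B ω = -1 := by
  filter_upwards [hAs, hBs] with ω h h'
  rcases h with h | h <;> rcases h' with h' | h' <;> simp [h, h']

variable [IsProbabilityMeasure P]

theorem integrable_of_ae_sign (hA : Measurable A) (hAs : ∀ᵐ ω ∂P, A ω = 1 ∨ A ω = -1) :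
    Integrable A P := by
  refine Integrable.of_bound hA.aestronglyMeasurable 1 ?_
  filter_upwards [hAs] with ω h
  rcases h with h | h <;> simp [h]

theorem integral_sign_pair (hA : Measurable A) (hB : Measurable B)
    (hAs : ∀ᵐ ω ∂P, A ω = 1 ∨ A ω = -1) (hBs : ∀ᵐ ω ∂P, B ω = 1 ∨ B ω = -1) (g : ℝ → ℝ → ℝ) :
    ∫ ω, g (A ω) (B ω) ∂P = (g 1 1 + g 1 (-1) + g (-1) 1 + g (-1) (-1)) / 4
      + (g 1 1 + g 1 (-1) - g (-1) 1 - g (-1) (-1)) / 4 * ∫ ω, A ω ∂P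
      + (g 1 1 - g 1 (-1) + g (-1) 1 - g (-1) (-1)) / 4 * ∫ ω, B ω ∂P
      + (g 1 1 - g 1 (-1) - g (-1) 1 + g (-1) (-1)) / 4 * ∫ ω, A ω * B ω ∂P := by
  have iA := integrable_of_ae_sign hA hAs
  have iB := integrable_of_ae_sign hB hBs
  have iAB : Integrable (fun ω => A ω * B ω) P :=
    integrable_of_ae_sign (hA.mul hB) (ae_sign_mul hAs hBs)
  rw [integral_congr_ae (by
    filter_upwards [hAs, hBs] with ω h h' using sign_expansion g h h')]
  rw [integral_add (by fun_prop) (iAB.const_mul _), integral_add (by fun_prop) (iB.const_mul _),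
    integral_add (by fun_prop) (iA.const_mul _)]
  simp only [integral_const_mul, integral_const, probReal_univ, smul_eq_mul, one_mul]

theorem probReal_ne_of_ae_sign (hA : Measurable A) (hB : Measurable B)
    (hAs : ∀ᵐ ω ∂P, A ω = 1 ∨ A ω = -1) (hBs : ∀ᵐ ω ∂P, B ω = 1 ∨ B ω = -1) :
    P.real {ω | A ω ≠ B ω} = (1 - ∫ ω, A ω * B ω ∂P) / 2 := by
  have h := integral_sign_pair hA hB hAs hBs (fun a b => if a ≠ b then 1 else 0)
  have hm : MeasurableSet {ω | A ω ≠ B ω} := (measurableSet_eq_fun hA hB).compl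
  rw [← integral_indicator_one hm]
  have e : (fun ω => Set.indicator {ω | A ω ≠ B ω} (1 : Ω → ℝ) ω) =
      fun ω => if A ω ≠ B ω then (1 : ℝ) else 0 := by
    funext ω; simp [Set.indicator]
  rw [e, h]
  norm_num
  ring

/-- The four joint probabilities of two sign variables are nonnegative. -/
theorem sign_pair_bounds (hA : Measurable A) (hB : Measurable B)
    (hAs : ∀ᵐ ω ∂P, A ω = 1 ∨ A ω = -1) (hBs : ∀ᵐ ω ∂P, B ω = 1 ∨ B ω = -1) :
    |∫ ω, A ω ∂P + ∫ ω, B ω ∂P| - 1 ≤ ∫ ω, A ω * B ω ∂P ∧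
      ∫ ω, A ω * B ω ∂P ≤ 1 - |∫ ω, A ω ∂P - ∫ ω, B ω ∂P| := by
  have key : ∀ s r : ℝ, (s = 1 ∨ s = -1) → (r = 1 ∨ r = -1) →
      0 ≤ 1 + s * ∫ ω, A ω ∂P + r * ∫ ω, B ω ∂P + s * r * ∫ ω, A ω * B ω ∂P := by
    intro s r hs hr
    have h := integral_sign_pair hA hB hAs hBs (fun a b => (1 + s * a) * (1 + r * b))
    have h0 : 0 ≤ ∫ ω, (1 + s * A ω) * (1 + r * B ω) ∂P := by
      refine integral_nonneg_of_ae ?_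
      filter_upwards [hAs, hBs] with ω h1 h2
      rcases hs with rfl | rfl <;> rcases hr with rfl | rfl <;> rcases h1 with h1 | h1 <;>
        rcases h2 with h2 | h2 <;> norm_num [h1, h2]
    rw [h] at h0
    linarith
  have h1 := key 1 1 (by simp) (by simp)
  have h2 := key 1 (-1) (by simp) (by simp)
  have h3 := key (-1) 1 (by simp) (by simp)
  have h4 := key (-1) (-1) (by simp) (by simp)
  have h5 : |∫ ω, A ω ∂P + ∫ ω, B ω ∂P| ≤ 1 + ∫ ω, A ω * B ω ∂P := by
    rw [abs_le]; constructor <;> linarith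
  have h6 : |∫ ω, A ω ∂P - ∫ ω, B ω ∂P| ≤ 1 - ∫ ω, A ω * B ω ∂P := by
    rw [abs_le]; constructor <;> linarith
  constructor <;> linarith

theorem identDistrib_sign_pair {Ω' : Type*} [MeasurableSpace Ω'] {Q : Measure Ω'}
    [IsProbabilityMeasure Q] {A' B' : Ω' → ℝ} (hA : Measurable A) (hB : Measurable B)
    (hAs : ∀ᵐ ω ∂P, A ω = 1 ∨ A ω = -1) (hBs : ∀ᵐ ω ∂P, B ω = 1 ∨ B ω = -1)
    (hA' : Measurable A') (hB' : Measurable B')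
    (hAs' : ∀ᵐ ω ∂Q, A' ω = 1 ∨ A' ω = -1) (hBs' : ∀ᵐ ω ∂Q, B' ω = 1 ∨ B' ω = -1)
    (h1 : ∫ ω, A ω ∂P = ∫ ω, A' ω ∂Q) (h2 : ∫ ω, B ω ∂P = ∫ ω, B' ω ∂Q)
    (h3 : ∫ ω, A ω * B ω ∂P = ∫ ω, A' ω * B' ω ∂Q) :
    IdentDistrib (fun ω => (A ω, B ω)) (fun ω => (A' ω, B' ω)) P Q := by
  classical
  refine ⟨(hA.prodMk hB).aemeasurable, (hA'.prodMk hB').aemeasurable, ?_⟩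
  ext s hs
  rw [Measure.map_apply (hA.prodMk hB) hs, Measure.map_apply (hA'.prodMk hB') hs,
    ← measureReal_eq_measureReal_iff, ← integral_indicator_one ((hA.prodMk hB) hs),
    ← integral_indicator_one ((hA'.prodMk hB') hs)]
  have e := integral_sign_pair hA hB hAs hBs (fun a b => s.indicator 1 (a, b))
  have e' := integral_sign_pair hA' hB' hAs' hBs' (fun a b => s.indicator 1 (a, b))
  rw [h1, h2, h3, ← e'] at e
  exact e

end SignVariables

/-! ### Finite chains of sign variables -/

/-- There are sign variables `X 0, …, X n` on a finite probability space, with means `x k`,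
correlations `b k` of the neighbours `X k`, `X (k + 1)`, and correlation `t` of the two ends. The
probability space is a finite type with weights `p`; the variables `X k` with `k > n` are
irrelevant. -/
def ChainRealizable (n : ℕ) (x b : ℕ → ℝ) (t : ℝ) : Prop :=
  ∃ (Ω : Type) (_ : Fintype Ω) (p : Ω → ℝ) (X : ℕ → Ω → ℝ),
    (∀ ω, 0 ≤ p ω) ∧ ∑ ω, p ω = 1 ∧ (∀ k ω, X k ω = 1 ∨ X k ω = -1) ∧
    (∀ k ≤ n, ∑ ω, p ω * X k ω = x k) ∧
    (∀ k < n, ∑ ω, p ω * (X k ω * X (k + 1) ω) = b k) ∧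
    ∑ ω, p ω * (X 0 ω * X n ω) = t

theorem sum_sign_pair {Ω : Type*} [Fintype Ω] {p A C : Ω → ℝ} {x y t : ℝ}
    (hA : ∀ ω, A ω = 1 ∨ A ω = -1) (hC : ∀ ω, C ω = 1 ∨ C ω = -1) (h1 : ∑ ω, p ω = 1)
    (hx : ∑ ω, p ω * A ω = x) (hy : ∑ ω, p ω * C ω = y) (ht : ∑ ω, p ω * (A ω * C ω) = t)
    (g : ℝ → ℝ → ℝ) :
    ∑ ω, p ω * g (A ω) (C ω) = (g 1 1 * (1 + x + y + t) + g 1 (-1) * (1 + x - y - t)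
      + g (-1) 1 * (1 - x + y - t) + g (-1) (-1) * (1 - x - y + t)) / 4 := by
  have e : ∀ ω, p ω * g (A ω) (C ω) =
      (g 1 1 + g 1 (-1) + g (-1) 1 + g (-1) (-1)) / 4 * p ω
      + (g 1 1 + g 1 (-1) - g (-1) 1 - g (-1) (-1)) / 4 * (p ω * A ω)
      + (g 1 1 - g 1 (-1) + g (-1) 1 - g (-1) (-1)) / 4 * (p ω * C ω)
      + (g 1 1 - g 1 (-1) - g (-1) 1 + g (-1) (-1)) / 4 * (p ω * (A ω * C ω)) := by
    intro ω
    rw [sign_expansion g (hA ω) (hC ω)]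
    ring
  simp only [e, Finset.sum_add_distrib, ← Finset.mul_sum, h1, hx, hy, ht]
  ring

/-- A conditional mean `h`, depending on `A` and `C` only, for a third sign variable with mean `z` and
correlations `t'` with `A` and `b` with `C`. Besides the compatibility of the means and the
correlations of each pair, the four inequalities of a triangle suffice. -/
theorem exists_conditional_mean {Ω : Type*} [Fintype Ω] {p A C : Ω → ℝ} {x y z t b t' : ℝ}
    (hp : ∀ ω, 0 ≤ p ω) (hA : ∀ ω, A ω = 1 ∨ A ω = -1) (hC : ∀ ω, C ω = 1 ∨ C ω = -1)
    (h1 : ∑ ω, p ω = 1) (hx : ∑ ω, p ω * A ω = x) (hy : ∑ ω, p ω * C ω = y)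
    (ht : ∑ ω, p ω * (A ω * C ω) = t)
    (hb : |y + z| - 1 ≤ b ∧ b ≤ 1 - |y - z|) (ht' : |x + z| - 1 ≤ t' ∧ t' ≤ 1 - |x - z|)
    (htri : |b + t'| - 1 ≤ t ∧ t ≤ 1 - |b - t'|) :
    ∃ h : Ω → ℝ, (∀ ω, |h ω| ≤ 1) ∧ ∑ ω, p ω * h ω = z ∧ ∑ ω, p ω * (h ω * C ω) = b ∧
      ∑ ω, p ω * (h ω * A ω) = t' := by
  have mass : ∀ α γ : ℝ, (α = 1 ∨ α = -1) → (γ = 1 ∨ γ = -1) →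
      0 ≤ 1 + α * x + γ * y + α * γ * t := by
    intro α γ hα hγ
    have e := sum_sign_pair hA hC h1 hx hy ht (fun a c => (1 + α * a) * (1 + γ * c))
    have e0 : 0 ≤ ∑ ω, p ω * ((1 + α * A ω) * (1 + γ * C ω)) := by
      refine Finset.sum_nonneg fun ω _ => mul_nonneg (hp ω) ?_
      rcases hα with rfl | rfl <;> rcases hγ with rfl | rfl <;> rcases hA ω with h | h <;>
        rcases hC ω with h' | h' <;> norm_num [h, h']
    rw [e] at e0
    linarith
  have m1 := mass 1 1 (by simp) (by simp)
  have m2 := mass 1 (-1) (by simp) (by simp)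
  have m3 := mass (-1) 1 (by simp) (by simp)
  have m4 := mass (-1) (-1) (by simp) (by simp)
  obtain ⟨b1, b2⟩ := hb
  obtain ⟨c1, c2⟩ := ht'
  obtain ⟨d1, d2⟩ := htri
  rw [sub_le_iff_le_add, abs_le] at b1 c1 d1
  rw [le_sub_comm, abs_le] at b2 c2 d2
  -- `e` is the third-order moment; it ranges over an intersection of four intervals.
  obtain ⟨e, ⟨e1, e1'⟩, ⟨e2, e2'⟩, ⟨e3, e3'⟩, e4, e4'⟩ : ∃ e : ℝ,
      (-(1 + x + y + t) ≤ z + b + t' + e ∧ z + b + t' + e ≤ 1 + x + y + t) ∧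
      (-(1 + x - y - t) ≤ z - b + t' - e ∧ z - b + t' - e ≤ 1 + x - y - t) ∧
      (-(1 - x + y - t) ≤ z + b - t' - e ∧ z + b - t' - e ≤ 1 - x + y - t) ∧
      (-(1 - x - y + t) ≤ z - b - t' + e ∧ z - b - t' + e ≤ 1 - x - y + t) := by
    refine ⟨max (max (-(1 + x + y + t) - (z + b + t')) (z - b + t' - (1 + x - y - t)))
      (max (z + b - t' - (1 - x + y - t)) (-(1 - x - y + t) - (z - b - t'))), ?_⟩
    generalize hm : max (max (-(1 + x + y + t) - (z + b + t')) (z - b + t' - (1 + x - y - t)))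
      (max (z + b - t' - (1 - x + y - t)) (-(1 - x - y + t) - (z - b - t'))) = m
    have l1 : -(1 + x + y + t) - (z + b + t') ≤ m := hm ▸ le_max_of_le_left (le_max_left _ _)
    have l2 : z - b + t' - (1 + x - y - t) ≤ m := hm ▸ le_max_of_le_left (le_max_right _ _)
    have l3 : z + b - t' - (1 - x + y - t) ≤ m := hm ▸ le_max_of_le_right (le_max_left _ _)
    have l4 : -(1 - x - y + t) - (z - b - t') ≤ m := hm ▸ le_max_of_le_right (le_max_right _ _)
    have u1 : m ≤ 1 + x + y + t - (z + b + t') := by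
      rw [← hm]; refine max_le (max_le ?_ ?_) (max_le ?_ ?_) <;> linarith
    have u2 : m ≤ z - b + t' + (1 + x - y - t) := by
      rw [← hm]; refine max_le (max_le ?_ ?_) (max_le ?_ ?_) <;> linarith
    have u3 : m ≤ z + b - t' + (1 - x + y - t) := by
      rw [← hm]; refine max_le (max_le ?_ ?_) (max_le ?_ ?_) <;> linarith
    have u4 : m ≤ 1 - x - y + t - (z - b - t') := by
      rw [← hm]; refine max_le (max_le ?_ ?_) (max_le ?_ ?_) <;> linarith
    refine ⟨⟨?_, ?_⟩, ⟨?_, ?_⟩, ⟨?_, ?_⟩, ?_, ?_⟩ <;> linarith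
  set H : ℝ → ℝ → ℝ := fun α γ =>
    (z + b * γ + t' * α + e * (α * γ)) / (1 + x * α + y * γ + t * (α * γ)) with hH
  -- Where the denominator vanishes, so does the numerator, and the quotient `0` is correct.
  have cancel : ∀ {n m : ℝ}, -m ≤ n → n ≤ m → n / m * m = n := by
    intro n m h h'
    rcases eq_or_ne m 0 with hm | hm
    · have : n = 0 := by linarith
      simp [this]
    · exact div_mul_cancel₀ n hm
  have k1 : H 1 1 * (1 + x + y + t) = z + b + t' + e := by
    rw [← cancel e1 e1', hH]; ring
  have k2 : H 1 (-1) * (1 + x - y - t) = z - b + t' - e := by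
    rw [← cancel e2 e2', hH]; ring
  have k3 : H (-1) 1 * (1 - x + y - t) = z + b - t' - e := by
    rw [← cancel e3 e3', hH]; ring
  have k4 : H (-1) (-1) * (1 - x - y + t) = z - b - t' + e := by
    rw [← cancel e4 e4', hH]; ring
  refine ⟨fun ω => H (A ω) (C ω), ?_, ?_, ?_, ?_⟩
  · have quot : ∀ n m : ℝ, -m ≤ n → n ≤ m → |n / m| ≤ 1 := by
      intro n m h h'
      have : 0 ≤ m := by linarith
      rw [abs_div, abs_of_nonneg this]
      exact div_le_one_of_le₀ (abs_le.2 ⟨h, h'⟩) this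
    intro ω
    rcases hA ω with h | h <;> rcases hC ω with h' | h' <;> simp only [h, h', hH] <;>
      apply quot <;> linarith
  · rw [sum_sign_pair hA hC h1 hx hy ht H]
    linarith
  · rw [sum_sign_pair hA hC h1 hx hy ht (fun a c => H a c * c)]
    linarith
  · rw [sum_sign_pair hA hC h1 hx hy ht (fun a c => H a c * a)]
    linarith

/-- The extension adjoins to the sample space one random sign, whose conditional mean is a function
of the two ends of the given chain. -/
theorem ChainRealizable.succ {n : ℕ} {x b : ℕ → ℝ} {t t' : ℝ} (hr : ChainRealizable n x b t)
    (hb : |x n + x (n + 1)| - 1 ≤ b n ∧ b n ≤ 1 - |x n - x (n + 1)|)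
    (ht' : |x 0 + x (n + 1)| - 1 ≤ t' ∧ t' ≤ 1 - |x 0 - x (n + 1)|)
    (htri : |b n + t'| - 1 ≤ t ∧ t ≤ 1 - |b n - t'|) :
    ChainRealizable (n + 1) x b t' := by
  obtain ⟨Ω, _, p, X, hp, h1, hX, hx, hbX, ht⟩ := hr
  obtain ⟨h, habs, hz, hbz, htz⟩ := exists_conditional_mean hp (hX 0) (hX n) h1
    (hx 0 (Nat.zero_le n)) (hx n le_rfl) ht hb ht' htri
  set sg : Bool → ℝ := fun s => if s then 1 else -1 with hsg
  set q : Ω × Bool → ℝ := fun a => p a.1 * (1 + sg a.2 * h a.1) / 2 with hq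
  have old : ∀ f : Ω → ℝ, ∑ a, q a * f a.1 = ∑ ω, p ω * f ω := by
    intro f
    rw [Fintype.sum_prod_type]
    refine Finset.sum_congr rfl fun ω _ => ?_
    simp only [Fintype.sum_bool, hq, hsg]
    norm_num
    ring
  have new : ∀ f : Ω → ℝ, ∑ a, q a * (f a.1 * sg a.2) = ∑ ω, p ω * (h ω * f ω) := by
    intro f
    rw [Fintype.sum_prod_type]
    refine Finset.sum_congr rfl fun ω _ => ?_
    simp only [Fintype.sum_bool, hq, hsg]
    norm_num
    ring
  refine ⟨Ω × Bool, inferInstance, q, fun k a => if k = n + 1 then sg a.2 else X k a.1,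
    ?_, ?_, ?_, ?_, ?_, ?_⟩
  · rintro ⟨ω, s⟩
    have := abs_le.1 (habs ω)
    refine div_nonneg (mul_nonneg (hp ω) ?_) (by norm_num)
    cases s <;> simp [hsg] <;> linarith
  · simpa [h1] using old fun _ => 1
  · rintro k ⟨ω, s⟩
    dsimp only
    split_ifs
    · cases s <;> simp [hsg]
    · exact hX k ω
  · intro k hk
    rcases Nat.lt_or_ge n k with hk' | hk'
    · obtain rfl : k = n + 1 := by omega
      simpa [hz] using new fun _ => 1
    · simp only [show k ≠ n + 1 by omega, if_false, old, hx k hk']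
  · intro k hk
    rcases Nat.lt_or_ge k n with hk' | hk'
    · simp only [show k ≠ n + 1 by omega, show k + 1 ≠ n + 1 by omega, if_false]
      exact (old fun ω => X k ω * X (k + 1) ω).trans (hbX k hk')
    · obtain rfl : k = n := by omega
      simp only [show k ≠ k + 1 by omega, if_false, if_true]
      exact (new (X k)).trans hbz
  · simp only [show 0 ≠ n + 1 by omega, if_false, if_true]
    exact (new (X 0)).trans htz

theorem chainRealizable_zero {x b : ℕ → ℝ} (hx : |x 0| ≤ 1) : ChainRealizable 0 x b 1 := by
  rw [abs_le] at hx
  refine ⟨Bool, inferInstance, fun s => (1 + (if s then 1 else -1) * x 0) / 2,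
    fun _ s => if s then 1 else -1, ?_, ?_, ?_, ?_, ?_, ?_⟩
  · intro s; cases s <;> simp <;> linarith
  · simp; ring
  · intro _ s; cases s <;> simp
  · intro k hk
    obtain rfl : k = 0 := by omega
    simp; ring
  · intro k hk; omega
  · simp; ring

theorem abs_le_one_of_pair_bounds {y z b : ℝ} (hb : |y + z| - 1 ≤ b ∧ b ≤ 1 - |y - z|) :
    |y| ≤ 1 ∧ |z| ≤ 1 ∧ |b| ≤ 1 := by
  obtain ⟨b1, b2⟩ := hb
  have h1 := abs_nonneg (y + z)
  have h2 := abs_nonneg (y - z)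
  rw [sub_le_iff_le_add, abs_le] at b1
  rw [le_sub_comm, abs_le] at b2
  refine ⟨abs_le.2 ⟨?_, ?_⟩, abs_le.2 ⟨?_, ?_⟩, abs_le.2 ⟨?_, ?_⟩⟩ <;> linarith

theorem chainRealizable_one {x b : ℕ → ℝ}
    (hb : |x 0 + x 1| - 1 ≤ b 0 ∧ b 0 ≤ 1 - |x 0 - x 1|) : ChainRealizable 1 x b (b 0) := by
  obtain ⟨h0, -, hb1⟩ := abs_le_one_of_pair_bounds hb
  refine (chainRealizable_zero h0).succ hb hb ⟨?_, by simp⟩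
  rw [abs_le] at hb1
  rw [sub_le_iff_le_add, abs_le]
  constructor <;> linarith

/-! ### Chains in which every other pair is coupled maximally -/

/-- The largest `∑ k ≤ n, ± a k` with an even number (first component) and with an odd number (second
component) of minus signs, by recursion on the sign of the last term. -/
noncomputable def maxSigned (a : ℕ → ℝ) : ℕ → ℝ × ℝ
  | 0 => (a 0, -a 0)
  | n + 1 => (max ((maxSigned a n).1 + a (n + 1)) ((maxSigned a n).2 - a (n + 1)),
      max ((maxSigned a n).2 + a (n + 1)) ((maxSigned a n).1 - a (n + 1)))

theorem exists_signs_maxSigned (a : ℕ → ℝ) (n : ℕ) :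
    (∃ ε : ℕ → ℝ, (∀ k, ε k = 1 ∨ ε k = -1) ∧ ∏ k ∈ Finset.range (n + 1), ε k = 1 ∧
      ∑ k ∈ Finset.range (n + 1), ε k * a k = (maxSigned a n).1) ∧
    (∃ ε : ℕ → ℝ, (∀ k, ε k = 1 ∨ ε k = -1) ∧ ∏ k ∈ Finset.range (n + 1), ε k = -1 ∧
      ∑ k ∈ Finset.range (n + 1), ε k * a k = (maxSigned a n).2) := by
  induction n with
  | zero =>
    exact ⟨⟨fun _ => 1, by simp, by simp, by simp [maxSigned]⟩,
      ⟨fun _ => -1, by simp, by simp, by simp [maxSigned]⟩⟩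
  | succ n ih =>
    obtain ⟨⟨ε, hε, pε, sε⟩, ⟨δ, hδ, pδ, sδ⟩⟩ := ih
    -- Signs for the first `n + 1` terms are prolonged by a sign for the next term.
    have ext : ∀ (η : ℕ → ℝ) (s : ℝ), (∀ k, η k = 1 ∨ η k = -1) → (s = 1 ∨ s = -1) →
        ∃ η' : ℕ → ℝ, (∀ k, η' k = 1 ∨ η' k = -1) ∧
          ∏ k ∈ Finset.range (n + 1 + 1), η' k = (∏ k ∈ Finset.range (n + 1), η k) * s ∧
          ∑ k ∈ Finset.range (n + 1 + 1), η' k * a k =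
            ∑ k ∈ Finset.range (n + 1), η k * a k + s * a (n + 1) := by
      intro η s hη hs
      refine ⟨Function.update η (n + 1) s, ?_, ?_, ?_⟩
      · intro k
        by_cases hk : k = n + 1
        · subst hk; simpa using hs
        · simpa [Function.update_of_ne hk] using hη k
      · rw [Finset.prod_range_succ, Function.update_self]
        congr 1
        refine Finset.prod_congr rfl fun k hk => ?_
        rw [Function.update_of_ne (Finset.mem_range.1 hk).ne]
      · rw [Finset.sum_range_succ, Function.update_self]
        congr 1
        refine Finset.sum_congr rfl fun k hk => ?_
        rw [Function.update_of_ne (Finset.mem_range.1 hk).ne]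
    obtain ⟨ε₁, h1, p1, s1⟩ := ext ε 1 hε (by simp)
    obtain ⟨ε₂, h2, p2, s2⟩ := ext ε (-1) hε (by simp)
    obtain ⟨δ₁, h3, p3, s3⟩ := ext δ 1 hδ (by simp)
    obtain ⟨δ₂, h4, p4, s4⟩ := ext δ (-1) hδ (by simp)
    rw [pε] at p1 p2
    rw [pδ] at p3 p4
    rw [sε] at s1 s2
    rw [sδ] at s3 s4
    simp only [maxSigned]
    constructor
    · rcases le_total ((maxSigned a n).2 - a (n + 1)) ((maxSigned a n).1 + a (n + 1)) with h | h
      · exact ⟨ε₁, h1, by rw [p1]; ring, by rw [s1, max_eq_left h]; ring⟩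
      · exact ⟨δ₂, h4, by rw [p4]; ring, by rw [s4, max_eq_right h]; ring⟩
    · rcases le_total ((maxSigned a n).1 - a (n + 1)) ((maxSigned a n).2 + a (n + 1)) with h | h
      · exact ⟨δ₁, h3, by rw [p3]; ring, by rw [s3, max_eq_left h]; ring⟩
      · exact ⟨ε₂, h2, by rw [p2]; ring, by rw [s2, max_eq_right h]; ring⟩

/-- `t` is one of the correlations allowed by the means `x`, `y` of the two variables and by further bounds
`e ≤ t ≤ o`. -/
def Window (x y e o t : ℝ) : Prop :=
  (|x + y| - 1 ≤ t ∧ t ≤ 1 - |x - y|) ∧ e ≤ t ∧ t ≤ o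

/-- Each lower bound of a window is at most each upper bound, so the window is nonempty (for
`|x|, |y| ≤ 1`). -/
structure WindowBounds (x y e o : ℝ) : Prop where
  lower_le_upper : e ≤ o
  lower_le : e ≤ 1 - |x - y|
  le_upper : |x + y| - 1 ≤ o

/-- A window is carried along a pair with correlation `b`. -/
theorem WindowBounds.step {x y z e o b : ℝ} (h : WindowBounds x y e o)
    (hb : |y + z| - 1 ≤ b ∧ b ≤ 1 - |y - z|) :
    WindowBounds x z (max (e + b) (-o - b) - 1) (1 + min (o - b) (b - e)) := by
  obtain ⟨h1, h2, h3⟩ := h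
  obtain ⟨hy, hz, hb1⟩ := abs_le_one_of_pair_bounds hb
  obtain ⟨b1, b2⟩ := hb
  rw [abs_le] at hb1
  have t1 := abs_sub_le x y z
  have t2 : |x - z| ≤ |x + y| + |y + z| := by
    have := abs_sub (x + y) (y + z); rwa [show x + y - (y + z) = x - z by ring] at this
  have t3 : |x + z| ≤ |x - y| + |y + z| := by
    have := abs_add_le (x - y) (y + z); rwa [show x - y + (y + z) = x + z by ring] at this
  have t4 : |x + z| ≤ |x + y| + |y - z| := by
    have := abs_sub (x + y) (y - z); rwa [show x + y - (y - z) = x + z by ring] at this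
  have a1 := abs_nonneg (x - y)
  have a2 := abs_nonneg (x + y)
  refine ⟨?_, ?_, ?_⟩
  · have : max (e + b) (-o - b) ≤ 2 + min (o - b) (b - e) := by
      refine max_le ?_ ?_ <;> rw [← sub_le_iff_le_add'] <;> refine le_min ?_ ?_ <;> linarith
    linarith
  · rw [sub_le_iff_le_add]
    refine max_le ?_ ?_ <;> linarith
  · rw [← sub_le_iff_le_add']
    refine le_min ?_ ?_ <;> linarith

/-- A window is carried along a maximally coupled pair; see `WindowBounds.window_of_widen` for why this
agrees with `WindowBounds.step`. -/
theorem WindowBounds.widen {x y z e o : ℝ} (h : WindowBounds x y e o) :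
    WindowBounds x z (e - |y - z|) (o + |y - z|) := by
  obtain ⟨h1, h2, h3⟩ := h
  have t1 := abs_sub_le x y z
  have t4 : |x + z| ≤ |x + y| + |y - z| := by
    have := abs_sub (x + y) (y - z); rwa [show x + y - (y - z) = x + z by ring] at this
  have a1 := abs_nonneg (y - z)
  refine ⟨?_, ?_, ?_⟩ <;> linarith

/-- Every correlation in the new window is compatible, on a triangle, with some correlation in the
old one: the intervals in question meet pairwise, hence have a common point. -/
theorem WindowBounds.exists_window {x y z e o b t' : ℝ} (h : WindowBounds x y e o) (hx : |x| ≤ 1)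
    (hb : |y + z| - 1 ≤ b ∧ b ≤ 1 - |y - z|)
    (ht' : Window x z (max (e + b) (-o - b) - 1) (1 + min (o - b) (b - e)) t') :
    ∃ t, Window x y e o t ∧ |b + t'| - 1 ≤ t ∧ t ≤ 1 - |b - t'| := by
  obtain ⟨h1, h2, h3⟩ := h
  obtain ⟨hy, hz, hb1⟩ := abs_le_one_of_pair_bounds hb
  obtain ⟨c, d1, d2⟩ := ht'
  obtain ⟨-, -, ht1⟩ := abs_le_one_of_pair_bounds c
  obtain ⟨b1, b2⟩ := hb
  obtain ⟨c1, c2⟩ := c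
  rw [sub_le_iff_le_add, max_le_iff] at d1
  rw [← sub_le_iff_le_add', le_min_iff] at d2
  rw [abs_le] at hx hy hz hb1 ht1
  rw [sub_le_iff_le_add, abs_le] at b1 c1
  rw [le_sub_comm, abs_le] at b2 c2
  have A1 : |x + y| ≤ 2 - |x - y| := by
    rw [le_sub_comm, abs_le]
    constructor <;> (rcases abs_cases (x + y) with ⟨q, -⟩ | ⟨q, -⟩ <;> rw [q] <;> linarith)
  have A2 : |b + t'| ≤ 2 - |b - t'| := by
    rw [le_sub_comm, abs_le]
    constructor <;> (rcases abs_cases (b + t') with ⟨q, -⟩ | ⟨q, -⟩ <;> rw [q] <;> linarith)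
  have A3 : |x + y| ≤ 2 - |b - t'| := by
    rw [le_sub_comm, abs_le]
    constructor <;> (rcases abs_cases (x + y) with ⟨q, -⟩ | ⟨q, -⟩ <;> rw [q] <;> linarith)
  have A4 : |b + t'| ≤ 2 - |x - y| := by
    rw [le_sub_comm, abs_le]
    constructor <;> (rcases abs_cases (b + t') with ⟨q, -⟩ | ⟨q, -⟩ <;> rw [q] <;> linarith)
  have A5 : |b + t'| ≤ 1 + o := by
    rw [abs_le]; constructor <;> linarith
  have A6 : |b - t'| ≤ 1 - e := by
    rw [abs_le]; constructor <;> linarith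
  refine ⟨max (|x + y| - 1) (max e (|b + t'| - 1)), ⟨⟨le_max_left _ _, ?_⟩,
    (le_max_left _ _).trans (le_max_right _ _), ?_⟩,
    (le_max_right _ _).trans (le_max_right _ _), ?_⟩ <;>
    refine max_le ?_ (max_le ?_ ?_) <;> linarith

/-- Along a maximally coupled pair, whose correlation is `1 - |y - z|`, a window is just widened
by `|y - z|`. -/
theorem WindowBounds.window_of_widen {x y z e o t' : ℝ} (h : WindowBounds x y e o)
    (hy : |y| ≤ 1) (hz : |z| ≤ 1) (ht' : Window x z (e - |y - z|) (o + |y - z|) t') :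
    Window x z (max (e + (1 - |y - z|)) (-o - (1 - |y - z|)) - 1)
      (1 + min (o - (1 - |y - z|)) ((1 - |y - z|) - e)) t' := by
  obtain ⟨h1, h2, h3⟩ := h
  obtain ⟨⟨c1, c2⟩, d1, d2⟩ := ht'
  rw [abs_le] at hy hz
  have A1 : |y + z| ≤ 2 - |y - z| := by
    rw [le_sub_comm, abs_le]
    constructor <;> (rcases abs_cases (y + z) with ⟨q, -⟩ | ⟨q, -⟩ <;> rw [q] <;> linarith)
  have t1 : |y - z| ≤ |x - y| + |x - z| := by
    have := abs_sub_le y x z; rwa [abs_sub_comm y x] at this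
  have t2 : |y - z| ≤ |x + y| + |x + z| := by
    have := abs_sub (x + y) (x + z); rwa [show x + y - (x + z) = y - z by ring] at this
  have a1 := abs_nonneg (x - z)
  have a2 := abs_nonneg (x + z)
  refine ⟨⟨c1, c2⟩, ?_, ?_⟩
  · rw [sub_le_iff_le_add]; refine max_le ?_ ?_ <;> linarith
  · rw [← sub_le_iff_le_add']; refine le_min ?_ ?_ <;> linarith

theorem maximal_pair_bounds {y z : ℝ} (hy : |y| ≤ 1) (hz : |z| ≤ 1) :
    |y + z| - 1 ≤ 1 - |y - z| ∧ 1 - |y - z| ≤ 1 - |y - z| := by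
  rw [abs_le] at hy hz
  refine ⟨?_, le_rfl⟩
  rcases abs_cases (y + z) with ⟨q, -⟩ | ⟨q, -⟩ <;> rcases abs_cases (y - z) with ⟨r, -⟩ | ⟨r, -⟩ <;>
    rw [q, r] <;> linarith

/-- If the pairs `X (2k)`, `X (2k+1)` have prescribed correlations and the pairs `X (2k+1)`, `X (2k+2)`
are coupled maximally, then the correlation of the two ends of the chain can be any number allowed by
the means and by the cycle inequalities with the signed sums of the prescribed correlations. The
number `K` counts `1` for each further context and `1 - b` for each maximally coupled pair with
correlation `b`. -/
theorem chainRealizable_of_window {x b : ℕ → ℝ}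
    (hb : ∀ k, |x k + x (k + 1)| - 1 ≤ b k ∧ b k ≤ 1 - |x k - x (k + 1)|)
    (hmax : ∀ k, b (2 * k + 1) = 1 - |x (2 * k + 1) - x (2 * k + 2)|) (n : ℕ) :
    let K : ℝ := n + ∑ k ∈ Finset.range n, |x (2 * k + 1) - x (2 * k + 2)|
    let M := maxSigned (fun k => b (2 * k)) n
    WindowBounds (x 0) (x (2 * n + 1)) (M.1 - K) (K - M.2) ∧
      ∀ t, Window (x 0) (x (2 * n + 1)) (M.1 - K) (K - M.2) t →
        ChainRealizable (2 * n + 1) x b t := by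
  have hx : ∀ k, |x k| ≤ 1 := fun k => (abs_le_one_of_pair_bounds (hb k)).1
  induction n with
  | zero =>
    simp only [maxSigned, Nat.cast_zero, Finset.range_zero, Finset.sum_empty, add_zero, mul_zero,
      zero_add, sub_zero, zero_sub, neg_neg]
    refine ⟨⟨le_rfl, (hb 0).2, (hb 0).1⟩, ?_⟩
    rintro t ⟨-, h1, h2⟩
    rw [le_antisymm h2 h1]
    exact chainRealizable_one (hb 0)
  | succ n ih =>
    obtain ⟨hw, hr⟩ := ih
    have hw' := hw.widen (z := x (2 * n + 2))
    set K : ℝ := n + ∑ k ∈ Finset.range n, |x (2 * k + 1) - x (2 * k + 2)| with hK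
    set M := maxSigned (fun k => b (2 * k)) n with hM
    set d := |x (2 * n + 1) - x (2 * n + 2)| with hd
    have hr' : ∀ t, Window (x 0) (x (2 * n + 2)) (M.1 - K - d) (K - M.2 + d) t →
        ChainRealizable (2 * n + 2) x b t := by
      intro t ht
      have hwin := hw.window_of_widen (hx _) (hx _) ht
      rw [← hmax n] at hwin
      obtain ⟨s, hs, htri⟩ := hw.exists_window (hx 0) (hb (2 * n + 1)) hwin
      exact (hr s hs).succ (hb _) ht.1 htri
    have eK : ((n + 1 : ℕ) : ℝ) + ∑ k ∈ Finset.range (n + 1), |x (2 * k + 1) - x (2 * k + 2)|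
        = K + d + 1 := by
      rw [Finset.sum_range_succ, hK, hd]; push_cast; ring
    have eL : (maxSigned (fun k => b (2 * k)) (n + 1)).1 - (K + d + 1) =
        max (M.1 - K - d + b (2 * n + 2)) (-(K - M.2 + d) - b (2 * n + 2)) - 1 := by
      simp only [maxSigned, ← hM, mul_add, mul_one]
      rw [← sub_sub, ← max_sub_sub_right]
      congr 2 <;> ring
    have eU : K + d + 1 - (maxSigned (fun k => b (2 * k)) (n + 1)).2 =
        1 + min (K - M.2 + d - b (2 * n + 2)) (b (2 * n + 2) - (M.1 - K - d)) := by
      simp only [maxSigned, ← hM, mul_add, mul_one]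
      rw [add_comm _ (1 : ℝ), add_sub_assoc, ← min_sub_sub_left]
      congr 2 <;> ring
    dsimp only
    rw [eK, eL, eU]
    refine ⟨hw'.step (hb (2 * n + 2)), fun t ht => ?_⟩
    obtain ⟨s, hs, htri⟩ := hw'.exists_window (hx 0) (hb (2 * n + 2)) ht
    exact (hr' s hs).succ (hb _) ht.1 htri

/-! ### From finite weights to probability measures -/

/-- A finite probability space as a measure space in an arbitrary universe. -/
theorem exists_probability_of_weights {Ω : Type} [Fintype Ω] {p : Ω → ℝ} (hp : ∀ ω, 0 ≤ p ω)
    (h1 : ∑ ω, p ω = 1) :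
    ∃ P : @Measure (ULift.{v} Ω) ⊤, @IsProbabilityMeasure _ ⊤ P ∧
      ∀ f : Ω → ℝ, @integral _ _ _ _ ⊤ P (fun ω => f ω.down) = ∑ ω, p ω * f ω := by
  let : MeasurableSpace (ULift.{v} Ω) := ⊤
  refine ⟨∑ ω, ENNReal.ofReal (p ω) • Measure.dirac (ULift.up ω), ⟨?_⟩, fun f => ?_⟩
  · simp [← ENNReal.ofReal_sum_of_nonneg fun ω _ => hp ω, h1]
  · rw [integral_finsetSum_measure]
    · refine Finset.sum_congr rfl fun ω _ => ?_
      rw [integral_smul_measure, integral_dirac, ENNReal.toReal_ofReal (hp ω), smul_eq_mul]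
    · intro ω _
      exact (integrable_dirac (by simp)).smul_measure ENNReal.ofReal_ne_top

/-- `ChainRealizable`, with a probability measure in place of finite weights. -/
theorem ChainRealizable.exists_probability {n : ℕ} {x b : ℕ → ℝ} {t : ℝ}
    (h : ChainRealizable n x b t) :
    ∃ (Ω : Type v) (_ : MeasurableSpace Ω) (P : Measure Ω) (_ : IsProbabilityMeasure P)
      (X : ℕ → Ω → ℝ), (∀ k, Measurable (X k)) ∧ (∀ k ω, X k ω = 1 ∨ X k ω = -1) ∧
      (∀ k ≤ n, ∫ ω, X k ω ∂P = x k) ∧ (∀ k < n, ∫ ω, X k ω * X (k + 1) ω ∂P = b k) ∧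
      ∫ ω, X 0 ω * X n ω ∂P = t := by
  obtain ⟨Ω, _, p, X, hp, h1, hX, hx, hb, ht⟩ := h
  obtain ⟨P, hP, hint⟩ := exists_probability_of_weights.{v} hp h1
  refine ⟨ULift.{v} Ω, ⊤, P, hP, fun k ω => X k ω.down, fun k => measurable_from_top,
    fun k ω => hX k ω.down, fun k hk => ?_, fun k hk => ?_, ?_⟩
  · rw [hint (X k), hx k hk]
  · rw [hint fun ω => X k ω * X (k + 1) ω, hb k hk]
  · rw [hint fun ω => X 0 ω * X n ω, ht]

/-! ### Maximal couplings of two sign variables -/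

section PairCoupling

variable {α β : Type u} [MeasurableSpace α] [MeasurableSpace β] {μ : Measure α} {ν : Measure β}
  {A : α → ℝ} {B : β → ℝ}

theorem measurableSet_isSign : MeasurableSet {r : ℝ | r = 1 ∨ r = -1} :=
  (measurableSet_singleton 1).union (measurableSet_singleton (-1))

/-- The probability of inequality in a coupling is at least the total variation distance. -/
theorem IsPairCoupling.abs_mean_sub_le (hA : ∀ ω, A ω = 1 ∨ A ω = -1)
    (hB : ∀ ω, B ω = 1 ∨ B ω = -1) {Ω : Type v} [MeasurableSpace Ω] {P : Measure Ω}
    [IsProbabilityMeasure P] {A' B' : Ω → ℝ} (h : IsPairCoupling μ ν A B P A' B') :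
    |∫ ω, A ω ∂μ - ∫ ω, B ω ∂ν| / 2 ≤ P.real {ω | A' ω ≠ B' ω} := by
  have hA' := h.identDistrib_left.symm.ae_snd measurableSet_isSign (Filter.Eventually.of_forall hA)
  have hB' := h.identDistrib_right.symm.ae_snd measurableSet_isSign (Filter.Eventually.of_forall hB)
  have := (sign_pair_bounds h.measurable_left h.measurable_right hA' hB').2
  rw [probReal_ne_of_ae_sign h.measurable_left h.measurable_right hA' hB',
    ← h.identDistrib_left.integral_eq, ← h.identDistrib_right.integral_eq]
  linarith

theorem probReal_eq_eq_one_sub {Ω : Type v} [MeasurableSpace Ω] {P : Measure Ω}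
    [IsProbabilityMeasure P] {A' B' : Ω → ℝ} (hA : Measurable A') (hB : Measurable B') :
    P.real {ω | A' ω = B' ω} = 1 - P.real {ω | A' ω ≠ B' ω} := by
  have := probReal_compl_eq_one_sub (μ := P) (measurableSet_eq_fun hA hB)
  change P.real {ω | A' ω ≠ B' ω} = _ at this
  linarith

variable [IsProbabilityMeasure μ] [IsProbabilityMeasure ν]

/-- The bound `IsPairCoupling.abs_mean_sub_le` is attained. -/
theorem exists_isPairCoupling_eq (hAm : Measurable A) (hBm : Measurable B)
    (hA : ∀ ω, A ω = 1 ∨ A ω = -1) (hB : ∀ ω, B ω = 1 ∨ B ω = -1) :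
    ∃ (Ω : Type v) (_ : MeasurableSpace Ω) (P : Measure Ω) (_ : IsProbabilityMeasure P)
      (A' B' : Ω → ℝ), IsPairCoupling μ ν A B P A' B' ∧
        P.real {ω | A' ω ≠ B' ω} = |∫ ω, A ω ∂μ - ∫ ω, B ω ∂ν| / 2 := by
  have hAs : ∀ᵐ ω ∂μ, A ω = 1 ∨ A ω = -1 := Filter.Eventually.of_forall hA
  have hBs : ∀ᵐ ω ∂ν, B ω = 1 ∨ B ω = -1 := Filter.Eventually.of_forall hB
  have a1 := (abs_le_one_of_pair_bounds (sign_pair_bounds hAm hAm hAs hAs)).1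
  have b1 := (abs_le_one_of_pair_bounds (sign_pair_bounds hBm hBm hBs hBs)).1
  obtain ⟨Ω, _, P, _, X, hXm, hX, hx, hb, -⟩ := (chainRealizable_one
    (x := fun k => if k = 0 then ∫ ω, A ω ∂μ else ∫ ω, B ω ∂ν)
    (b := fun _ => 1 - |∫ ω, A ω ∂μ - ∫ ω, B ω ∂ν|)
    (by simpa using maximal_pair_bounds a1 b1)).exists_probability
  have hXs : ∀ k, ∀ᵐ ω ∂P, X k ω = 1 ∨ X k ω = -1 := fun k => Filter.Eventually.of_forall (hX k)
  have x0 : ∫ ω, X 0 ω ∂P = ∫ ω, A ω ∂μ := by simpa using hx 0 (by norm_num)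
  have x1 : ∫ ω, X 1 ω ∂P = ∫ ω, B ω ∂ν := by simpa using hx 1 le_rfl
  -- The law of a single sign variable is that of the degenerate pair `(C, C)`, projected.
  have law : ∀ {γ : Type u} [MeasurableSpace γ] {ρ : Measure γ} [IsProbabilityMeasure ρ]
      {C : γ → ℝ} (k : ℕ), Measurable C → (∀ ω, C ω = 1 ∨ C ω = -1) →
      ∫ ω, X k ω ∂P = ∫ ω, C ω ∂ρ → IdentDistrib (X k) C P ρ := by
    intro γ _ ρ _ C k hC hCs hk
    have hCs' : ∀ᵐ ω ∂ρ, C ω = 1 ∨ C ω = -1 := Filter.Eventually.of_forall hCs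
    have e : ∀ {r : ℝ}, (r = 1 ∨ r = -1) → r * r = 1 := by rintro r (rfl | rfl) <;> norm_num
    exact (identDistrib_sign_pair (P := P) (Q := ρ) (hXm k) (hXm k) (hXs k) (hXs k) hC hC hCs' hCs' hk hk
      (by simp [e (hX k _), e (hCs _)])).comp measurable_fst
  refine ⟨Ω, _, P, ‹_›, X 0, X 1, ⟨hXm 0, hXm 1, law 0 hAm hA x0, law 1 hBm hB x1⟩, ?_⟩
  rw [probReal_ne_of_ae_sign (hXm 0) (hXm 1) (hXs 0) (hXs 1)]
  have := hb 0 one_pos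
  rw [zero_add] at this
  rw [this]
  ring

/-- A coupling is maximal exactly when its probability of inequality is the total variation distance
of the two laws. -/
theorem isMaximalCoupling_iff (hAm : Measurable A) (hBm : Measurable B)
    (hA : ∀ ω, A ω = 1 ∨ A ω = -1) (hB : ∀ ω, B ω = 1 ∨ B ω = -1) {Ω : Type v}
    [MeasurableSpace Ω] {P : Measure Ω} [IsProbabilityMeasure P] {A' B' : Ω → ℝ}
    (h : IsPairCoupling μ ν A B P A' B') :
    IsMaximalCoupling μ ν A B P A' B' ↔
      P.real {ω | A' ω ≠ B' ω} ≤ |∫ ω, A ω ∂μ - ∫ ω, B ω ∂ν| / 2 := by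
  constructor
  · rintro ⟨-, hmax⟩
    obtain ⟨Ω'', _, Q, _, A'', B'', hc, heq⟩ :=
      exists_isPairCoupling_eq.{u, v} (μ := μ) (ν := ν) hAm hBm hA hB
    have := hmax Ω'' Q A'' B'' hc
    rw [probReal_eq_eq_one_sub hc.measurable_left hc.measurable_right,
      probReal_eq_eq_one_sub h.measurable_left h.measurable_right, heq] at this
    linarith
  · refine fun hle => ⟨h, fun Ω'' _ Q _ A'' B'' hc => ?_⟩
    have := hc.abs_mean_sub_le hA hB
    rw [probReal_eq_eq_one_sub hc.measurable_left hc.measurable_right,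
      probReal_eq_eq_one_sub h.measurable_left h.measurable_right]
    linarith

end PairCoupling

/-! ### Couplings of a KCBS-system -/

namespace KCBSSystem

variable (S : KCBSSystem.{u})

theorem meanW_succ (i : Fin 5) : S.meanW (i + 1) = ∫ ω, S.Wnext i ω ∂(S.P i) := by
  have h : ∀ j, j = i → ∫ ω, S.Wnext j ω ∂(S.P j) = ∫ ω, S.Wnext i ω ∂(S.P i) := by
    rintro _ rfl; rfl
  exact h _ (add_sub_cancel_right i 1)

theorem ae_V (i : Fin 5) : ∀ᵐ ω ∂(S.P i), S.V i ω = 1 ∨ S.V i ω = -1 :=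
  Filter.Eventually.of_forall (S.binary_V i)

theorem ae_Wnext (i : Fin 5) : ∀ᵐ ω ∂(S.P i), S.Wnext i ω = 1 ∨ S.Wnext i ω = -1 :=
  Filter.Eventually.of_forall (S.binary_Wnext i)

theorem corr_bounds (i : Fin 5) : |S.meanV i + S.meanW (i + 1)| - 1 ≤ S.corr i ∧
    S.corr i ≤ 1 - |S.meanV i - S.meanW (i + 1)| := by
  rw [meanW_succ]
  exact sign_pair_bounds (S.measurable_V i) (S.measurable_Wnext i) (S.ae_V i) (S.ae_Wnext i)

namespace Coupling

variable {S} (c : Coupling.{u, v} S)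

theorem isPairCoupling (i : Fin 5) :
    IsPairCoupling (S.P i) (S.P (i - 1)) (S.V i) (S.W i) c.P (c.V i) (c.W i) := by
  refine ⟨c.measurable_V i, c.measurable_W i, (c.identDistrib i).comp measurable_fst, ?_⟩
  have h := (c.identDistrib (i - 1)).comp measurable_snd
  rw [sub_add_cancel] at h
  exact h

theorem ae_V (i : Fin 5) : ∀ᵐ ω ∂c.P, c.V i ω = 1 ∨ c.V i ω = -1 :=
  (c.isPairCoupling i).identDistrib_left.symm.ae_snd measurableSet_isSign (S.ae_V i)

theorem ae_W (i : Fin 5) : ∀ᵐ ω ∂c.P, c.W i ω = 1 ∨ c.W i ω = -1 :=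
  (c.isPairCoupling i).identDistrib_right.symm.ae_snd measurableSet_isSign (S.ae_Wnext (i - 1))

theorem integral_mul (i : Fin 5) : ∫ ω, c.V i ω * c.W (i + 1) ω ∂c.P = S.corr i :=
  ((c.identDistrib i).comp (measurable_fst.mul measurable_snd)).integral_eq

theorem abs_mean_sub_le (i : Fin 5) :
    |S.meanV i - S.meanW i| / 2 ≤ c.P.real {ω | c.V i ω ≠ c.W i ω} :=
  (c.isPairCoupling i).abs_mean_sub_le (S.binary_V i) (S.binary_Wnext (i - 1))

theorem delta0_le_mismatch : S.delta0 ≤ c.mismatch := by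
  rw [delta0, mismatch, Finset.mul_sum]
  refine Finset.sum_le_sum fun i _ => ?_
  linarith [c.abs_mean_sub_le i]

end Coupling

/-- Ten signs in a cycle: the product of the five products `V i * W (i ⊕ 1)`, with an odd number of
sign changes, and of the five products `V i * W i` is `-1`, so not all ten terms are `1`. -/
theorem sum_signs_le_eight {V W : Fin 5 → ℝ} (hV : ∀ i, V i = 1 ∨ V i = -1)
    (hW : ∀ i, W i = 1 ∨ W i = -1) {T : Finset (Fin 5)} (hT : Odd T.card) :
    ∑ i, (if i ∈ T then -(V i * W (i + 1)) else V i * W (i + 1)) + ∑ i, V i * W i ≤ 8 := by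
  set f : Fin 5 ⊕ Fin 5 → ℝ := Sum.elim
    (fun i => if i ∈ T then -(V i * W (i + 1)) else V i * W (i + 1)) (fun i => V i * W i) with hf
  have hfs : ∀ j, f j = 1 ∨ f j = -1 := by
    rintro (i | i)
    · simp only [hf, Sum.elim_inl]
      split_ifs <;> rcases hV i with h | h <;> rcases hW (i + 1) with h' | h' <;> simp [h, h']
    · simp only [hf, Sum.elim_inr]
      rcases hV i with h | h <;> rcases hW i with h' | h' <;> simp [h, h']
  have hprod : ∏ j, f j = -1 := by
    have e : ∀ i, (if i ∈ T then -(V i * W (i + 1)) else V i * W (i + 1)) =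
        (if i ∈ T then (-1 : ℝ) else 1) * (V i * W (i + 1)) := by
      intro i; split_ifs <;> ring
    have shift : ∏ i, W (i + 1) = ∏ i, W i := Equiv.prod_comp (Equiv.addRight (1 : Fin 5)) W
    have sq : ∀ {U : Fin 5 → ℝ}, (∀ i, U i = 1 ∨ U i = -1) → (∏ i, U i) * ∏ i, U i = 1 := by
      intro U hU
      rw [← Finset.prod_mul_distrib]
      exact Finset.prod_eq_one fun i _ => by rcases hU i with h | h <;> simp [h]
    rw [Fintype.prod_sum_type]
    simp only [hf, Sum.elim_inl, Sum.elim_inr, e, Finset.prod_mul_distrib, shift]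
    rw [Finset.prod_ite_mem, Finset.univ_inter, Finset.prod_const, hT.neg_one_pow]
    linear_combination -(∏ i, W i) * (∏ i, W i) * sq hV - sq hW
  obtain ⟨j, hj⟩ : ∃ j, f j = -1 := by
    by_contra! hne
    have : ∏ j, f j = 1 := Finset.prod_eq_one fun j _ => (hfs j).resolve_right (hne j)
    linarith
  have hsum : ∑ j, f j ≤ ∑ j', (if j' = j then (-1 : ℝ) else 1) := by
    refine Finset.sum_le_sum fun j' _ => ?_
    split_ifs with h
    · rw [h, hj]
    · rcases hfs j' with h' | h' <;> norm_num [h']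
  have hval : ∑ j', (if j' = j then (-1 : ℝ) else 1) = 8 := by
    rw [← Finset.add_sum_erase _ _ (Finset.mem_univ j), Finset.sum_congr rfl fun j' hj' =>
      if_neg (Finset.ne_of_mem_erase hj')]
    simp [Finset.card_erase_of_mem]
    norm_num
  rw [hval, Fintype.sum_sum_type] at hsum
  exact hsum

/-- The lower bound for the mismatch in terms of the correlations: the pointwise inequality
`sum_signs_le_eight`, integrated. -/
theorem sOdd_le_mismatch {S : KCBSSystem.{u}} (c : Coupling.{u, v} S) :
    sOdd S.corr ≤ 3 + 2 * c.mismatch := by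
  refine (Finset.sup'_le_iff _ _).2 fun T hT => ?_
  have hT' : Odd T.card := by simpa [oddSets] using hT
  have iVW : ∀ i j, Integrable (fun ω => c.V i ω * c.W j ω) c.P := fun i j =>
    integrable_of_ae_sign ((c.measurable_V i).mul (c.measurable_W j))
      (ae_sign_mul (c.ae_V i) (c.ae_W j))
  have i1 : ∀ i, Integrable (fun ω => if i ∈ T then -(c.V i ω * c.W (i + 1) ω)
      else c.V i ω * c.W (i + 1) ω) c.P := by
    intro i
    split_ifs
    exacts [(iVW i (i + 1)).neg, iVW i (i + 1)]
  have e1 : ∫ ω, ∑ i, (if i ∈ T then -(c.V i ω * c.W (i + 1) ω)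
      else c.V i ω * c.W (i + 1) ω) ∂c.P = signedSum S.corr T := by
    rw [integral_finsetSum _ fun i _ => i1 i]
    refine Finset.sum_congr rfl fun i _ => ?_
    split_ifs
    · rw [integral_neg, c.integral_mul]
    · exact c.integral_mul i
  have e2 : ∫ ω, ∑ i, c.V i ω * c.W i ω ∂c.P = 5 - 2 * c.mismatch := by
    rw [integral_finsetSum _ fun i _ => iVW i i, Coupling.mismatch, Finset.mul_sum,
      show (5 : ℝ) = ∑ _i : Fin 5, 1 by simp, ← Finset.sum_sub_distrib]
    refine Finset.sum_congr rfl fun i _ => ?_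
    rw [probReal_ne_of_ae_sign (c.measurable_V i) (c.measurable_W i) (c.ae_V i) (c.ae_W i)]
    ring
  have h8 : ∫ ω, (∑ i, (if i ∈ T then -(c.V i ω * c.W (i + 1) ω)
      else c.V i ω * c.W (i + 1) ω) + ∑ i, c.V i ω * c.W i ω) ∂c.P ≤ ∫ _, 8 ∂c.P := by
    refine integral_mono_ae ((integrable_finsetSum _ fun i _ => i1 i).add
      (integrable_finsetSum _ fun i _ => iVW i i)) (integrable_const _) ?_
    filter_upwards [ae_all_iff.2 c.ae_V, ae_all_iff.2 c.ae_W] with ω hV hW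
    exact sum_signs_le_eight hV hW hT'
  rw [integral_add (integrable_finsetSum _ fun i _ => i1 i)
    (integrable_finsetSum _ fun i _ => iVW i i), e1, e2] at h8
  simp only [integral_const, probReal_univ, smul_eq_mul, one_mul] at h8
  linarith

theorem ofNat_succ (k : ℕ) : Fin.ofNat 5 (k + 1) = Fin.ofNat 5 k + 1 := by
  ext; simp [Fin.val_add]

theorem ofNat_val (i : Fin 5) : Fin.ofNat 5 i.val = i :=
  Fin.ext (Nat.mod_eq_of_lt i.isLt)

theorem maxSigned_le_sOdd (a : Fin 5 → ℝ) :
    (maxSigned (fun k => a (Fin.ofNat 5 k)) 4).2 ≤ sOdd a := by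
  obtain ⟨ε, hε, hp, hs⟩ := (exists_signs_maxSigned (fun k => a (Fin.ofNat 5 k)) 4).2
  set T : Finset (Fin 5) := Finset.univ.filter fun i => ε i.val = -1 with hT
  have hite : ∀ i : Fin 5, ε i.val = if i ∈ T then -1 else 1 := by
    intro i
    rcases hε i.val with h | h <;> norm_num [hT, h]
  have hodd : Odd T.card := by
    rw [← Fin.prod_univ_eq_prod_range] at hp
    rw [Finset.prod_congr rfl fun i _ => hite i, Finset.prod_ite_mem, Finset.univ_inter,
      Finset.prod_const] at hp
    by_contra hne
    rw [(Nat.not_odd_iff_even.1 hne).neg_one_pow] at hp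
    norm_num at hp
  rw [← hs, ← Fin.sum_univ_eq_sum_range (fun k => ε k * a (Fin.ofNat 5 k))]
  refine le_trans (le_of_eq ?_) (Finset.le_sup' (signedSum a) (by simpa [oddSets] using hodd))
  refine Finset.sum_congr rfl fun i _ => ?_
  rw [hite i, ofNat_val]
  split_ifs <;> ring

/-- The optimal coupling. The variables are arranged in the chain
`V 0, W 1, V 1, W 2, …, V 4, W 0`; the connections inside the chain are coupled maximally, and the
two ends, which form the remaining connection, are given the largest possible correlation. -/
theorem exists_coupling_mismatch_le :
    ∃ c : Coupling.{u, v} S, c.mismatch ≤ (1 / 2) * max (2 * S.delta0) (sOdd S.corr - 3) := by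
  -- Even positions `2 k` hold `V k`, odd positions `2 k + 1` hold `W (k + 1)`; thus position `9` is
  -- `W 0`.
  set x : ℕ → ℝ := fun m => if m % 2 = 0 then S.meanV (Fin.ofNat 5 (m / 2))
    else S.meanW (Fin.ofNat 5 (m / 2 + 1)) with hxdef
  set b : ℕ → ℝ := fun m => if m % 2 = 0 then S.corr (Fin.ofNat 5 (m / 2))
    else 1 - |x m - x (m + 1)| with hbdef
  have xe : ∀ k, x (2 * k) = S.meanV (Fin.ofNat 5 k) := fun k => by simp [hxdef]
  have xo : ∀ k, x (2 * k + 1) = S.meanW (Fin.ofNat 5 (k + 1)) := fun k => by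
    simp [hxdef, Nat.add_mod, show (2 * k + 1) / 2 = k by omega]
  have be : ∀ k, b (2 * k) = S.corr (Fin.ofNat 5 k) := fun k => by simp [hbdef]
  have bo : ∀ k, b (2 * k + 1) = 1 - |x (2 * k + 1) - x (2 * k + 2)| := fun k => by
    simp [hbdef, Nat.add_mod]
  have hx1 : ∀ m, |x m| ≤ 1 := by
    intro m
    obtain ⟨k, rfl | rfl⟩ : ∃ k, m = 2 * k ∨ m = 2 * k + 1 := ⟨m / 2, by omega⟩
    · rw [xe]; exact (abs_le_one_of_pair_bounds (S.corr_bounds (Fin.ofNat 5 k))).1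
    · rw [xo, ofNat_succ]; exact (abs_le_one_of_pair_bounds (S.corr_bounds (Fin.ofNat 5 k))).2.1
  have hb : ∀ m, |x m + x (m + 1)| - 1 ≤ b m ∧ b m ≤ 1 - |x m - x (m + 1)| := by
    intro m
    obtain ⟨k, rfl | rfl⟩ : ∃ k, m = 2 * k ∨ m = 2 * k + 1 := ⟨m / 2, by omega⟩
    · rw [xe, xo, be]; rw [ofNat_succ]; exact S.corr_bounds (Fin.ofNat 5 k)
    · rw [bo]; exact maximal_pair_bounds (hx1 _) (hx1 _)
  -- `o` is the bound that the cycle inequalities put on the last connection.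
  obtain ⟨⟨w1, w2, w3⟩, hreal⟩ := chainRealizable_of_window hb bo 4
  set K : ℝ := ((4 : ℕ) : ℝ) + ∑ k ∈ Finset.range 4, |x (2 * k + 1) - x (2 * k + 2)| with hK
  set o : ℝ := K - (maxSigned (fun k => b (2 * k)) 4).2 with ho
  have ho' : K - sOdd S.corr ≤ o := by
    have := maxSigned_le_sOdd S.corr
    simp only [ho, be]
    linarith
  obtain ⟨Ω, _, P, _, X, hXm, hX, hXx, hXb, hXt⟩ :=
    (hreal (min (1 - |x 0 - x (2 * 4 + 1)|) o)
      ⟨⟨le_min (maximal_pair_bounds (hx1 _) (hx1 _)).1 w3, min_le_left _ _⟩, le_min w2 w1,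
        min_le_right _ _⟩).exists_probability
  have hXs : ∀ k, ∀ᵐ ω ∂P, X k ω = 1 ∨ X k ω = -1 := fun k => Filter.Eventually.of_forall (hX k)
  let c : Coupling.{u, v} S :=
    { Ω := Ω
      P := P
      V := fun i => X (2 * i.val)
      W := fun i => X (2 * (i - 1).val + 1)
      measurable_V := fun i => hXm _
      measurable_W := fun i => hXm _
      identDistrib := fun i => by
        rw [add_sub_cancel_right]
        have hi := i.isLt
        refine identDistrib_sign_pair (hXm _) (hXm _) (hXs _) (hXs _) (S.measurable_V i)
          (S.measurable_Wnext i) (S.ae_V i) (S.ae_Wnext i) ?_ ?_ ?_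
        · rw [hXx _ (by omega), xe, ofNat_val]; rfl
        · rw [hXx _ (by omega), xo, ofNat_succ, ofNat_val, meanW_succ]
        · rw [hXb _ (by omega), be, ofNat_val]; rfl }
  refine ⟨c, ?_⟩
  have hne : ∀ j k, P.real {ω | X j ω ≠ X k ω} = (1 - ∫ ω, X j ω * X k ω ∂P) / 2 := fun j k =>
    probReal_ne_of_ae_sign (hXm j) (hXm k) (hXs j) (hXs k)
  have hinner : ∀ k < 4, P.real {ω | X (2 * k + 2) ω ≠ X (2 * k + 1) ω} =
      |x (2 * k + 1) - x (2 * k + 2)| / 2 := by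
    intro k hk
    rw [hne, integral_congr_ae (Filter.Eventually.of_forall fun ω => mul_comm _ _),
      hXb _ (by omega), bo]
    ring
  have hmis : c.mismatch = P.real {ω | X 0 ω ≠ X 9 ω} +
      ∑ k ∈ Finset.range 4, P.real {ω | X (2 * k + 2) ω ≠ X (2 * k + 1) ω} := by
    rw [Coupling.mismatch, Fin.sum_univ_succ, Finset.sum_range]
    rfl
  have hdelta : 2 * S.delta0 = |x 0 - x 9| +
      ∑ k ∈ Finset.range 4, |x (2 * k + 1) - x (2 * k + 2)| := by
    have e : ∀ k : ℕ, |x (2 * k + 1) - x (2 * k + 2)| =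
        |S.meanV (Fin.ofNat 5 (k + 1)) - S.meanW (Fin.ofNat 5 (k + 1))| := by
      intro k
      rw [abs_sub_comm, xo, show 2 * k + 2 = 2 * (k + 1) by ring, xe]
    simp only [e]
    have x0 : x 0 = S.meanV 0 := xe 0
    have x9 : x 9 = S.meanW 0 := xo 4
    rw [delta0, Fin.sum_univ_succ, Finset.sum_range, x0, x9]
    rw [← mul_assoc, mul_one_div_cancel two_ne_zero, one_mul]
    rfl
  rw [hmis, Finset.sum_congr rfl fun k hk => hinner k (Finset.mem_range.1 hk), ← Finset.sum_div,
    hne, hXt, hdelta]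
  norm_num only at ho' hK ⊢
  rcases le_total (1 - |x 0 - x 9|) o with h | h
  · rw [min_eq_left h]
    have := le_max_left (|x 0 - x 9| + ∑ k ∈ Finset.range 4, |x (2 * k + 1) - x (2 * k + 2)|)
      (sOdd S.corr - 3)
    linarith
  · rw [min_eq_right h]
    have := le_max_right (|x 0 - x 9| + ∑ k ∈ Finset.range 4, |x (2 * k + 1) - x (2 * k + 2)|)
      (sOdd S.corr - 3)
    linarith

theorem half_max_le_mismatch {S : KCBSSystem.{u}} (c : Coupling.{u, v} S) :
    (1 / 2) * max (2 * S.delta0) (sOdd S.corr - 3) ≤ c.mismatch := by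
  have := max_le (a := 2 * S.delta0) (b := sOdd S.corr - 3) (c := 2 * c.mismatch)
    (by linarith [c.delta0_le_mismatch]) (by linarith [sOdd_le_mismatch c])
  linarith

theorem deltaMin_eq :
    deltaMin.{u, v} S = (1 / 2) * max (2 * S.delta0) (sOdd S.corr - 3) := by
  obtain ⟨c, hc⟩ := exists_coupling_mismatch_le.{u, v} S
  refine IsLeast.csInf_eq ⟨⟨c, le_antisymm hc (half_max_le_mismatch c)⟩, ?_⟩
  rintro _ ⟨c', rfl⟩
  exact half_max_le_mismatch c'

/-- All connections of a coupling are coupled maximally exactly when its total mismatch is `Δ₀`. -/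
theorem Coupling.forall_isMaximalCoupling_iff {S : KCBSSystem.{u}} (c : Coupling.{u, v} S) :
    (∀ i, IsMaximalCoupling (S.P i) (S.P (i - 1)) (S.V i) (S.W i) c.P (c.V i) (c.W i)) ↔
      c.mismatch ≤ S.delta0 := by
  have hiff : ∀ i, IsMaximalCoupling (S.P i) (S.P (i - 1)) (S.V i) (S.W i) c.P (c.V i) (c.W i) ↔
      c.P.real {ω | c.V i ω ≠ c.W i ω} ≤ |S.meanV i - S.meanW i| / 2 := fun i =>
    isMaximalCoupling_iff (S.measurable_V i) (S.measurable_Wnext (i - 1)) (S.binary_V i)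
      (S.binary_Wnext (i - 1)) (c.isPairCoupling i)
  have hd : S.delta0 = ∑ i, |S.meanV i - S.meanW i| / 2 := by
    rw [delta0, ← Finset.sum_div]; ring
  rw [hd, Coupling.mismatch]
  constructor
  · exact fun h => Finset.sum_le_sum fun i _ => (hiff i).1 (h i)
  · intro h i
    have heq := (Finset.sum_eq_sum_iff_of_le fun i _ => c.abs_mean_sub_le i).1
      (le_antisymm (Finset.sum_le_sum fun i _ => c.abs_mean_sub_le i) h)
    exact (hiff i).2 (heq i (Finset.mem_univ i)).ge

theorem noncontextual_iff :
    Noncontextual.{u, v} S ↔ sOdd S.corr ≤ 3 + 2 * S.delta0 := by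
  constructor
  · rintro ⟨c, hc⟩
    linarith [sOdd_le_mismatch c, c.forall_isMaximalCoupling_iff.1 hc]
  · intro h
    obtain ⟨c, hc⟩ := exists_coupling_mismatch_le.{u, v} S
    rw [max_eq_left (by linarith)] at hc
    exact ⟨c, c.forall_isMaximalCoupling_iff.2 (by linarith)⟩

end KCBSSystem

theorem mainTheorem2 (S : KCBSSystem.{u}) :
    S.delta0 = (1 / 2) * ∑ i, |S.meanV i - S.meanW i| ∧
    KCBSSystem.deltaMin.{u, v} S = (1 / 2) * max (2 * S.delta0) (sOdd S.corr - 3) ∧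
    KCBSSystem.cntx.{u, v} S =
      (1 / 2) * max 0 (sOdd S.corr - 3 - ∑ i, |S.meanV i - S.meanW i|) ∧
    (KCBSSystem.Noncontextual.{u, v} S ↔
      sOdd S.corr ≤ 3 + ∑ i, |S.meanV i - S.meanW i|) := by
  have hd : ∑ i, |S.meanV i - S.meanW i| = 2 * S.delta0 := by
    rw [KCBSSystem.delta0]; ring
  refine ⟨rfl, S.deltaMin_eq, ?_, ?_⟩
  · rw [KCBSSystem.cntx, S.deltaMin_eq, hd, ← sub_self (2 * S.delta0), max_sub_sub_right]
    ring
  · rw [hd]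
    exact S.noncontextual_iff
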